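/- For all integers $n\ge 1$, all real $r,t>0$ and all real $\delta>0$ there is a real $\varepsilon>0$ such that the following holds. Let $G$ be a group acting on a set $X$, the action being written $g*x$, and let $S\subseteq G$ and $A\subseteq X$ be finite sets such that: 1. $\frac1\varepsilon<|A|^{1/r}\le|S|\le|A|^{r}$; 2. $\bigl|\{(a_1,\dots,a_n)\in A^n : |\mathrm{Stab}_{\langle S\rangle}(a_1,\dots,a_n)|\ge|A|^{t}\}\bigr|\le|A|^{n-\delta}$, where $\langle S\rangle$ is the subgroup of $G$ generated by $S$ and $\mathrm{Stab}_{\langle S\rangle}(a_1,\dots,a_n)=\{g\in\langle S\rangle : g*a_i=a_i\text{ for all }i\}$ (an infinite stabiliser satisfies the inequality $|\mathrm{Stab}|\ge|A|^t$); 3. $|\{(s,a,b)\in S\times A\times A : s*a=b\}|\ge|S||A|^{1-\varepsilon}$. Then there are a finite $|A|^{\delta}$-approximate subgroup $H\subseteq G$ and a subset $T\subseteq A$ such that: 1. $|H|\le|A|^{n+t+\delta}$, and $|H\cap hS|\ge|A|^{-\delta}|S|$ for some $h\in G$; 2. $|T|\ge|A|^{1-\delta}$; 3. $|H*T|\le|A|^{1+\delta}$,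 where $H*T=\{g*x : g\in H,\ x\in T\}$. Here a $K$-approximate subgroup of $G$ is a subset $H$ with $1\in H$, $H=H^{-1}$ and $H\cdot H\subseteq F\cdot H$ for some finite $F\subseteq G$ with $|F|\le K$. -/

import Mathlib

open scoped Pointwise

section BSGAction

variable {G X : Type*} [Group G] [MulAction G X]

/-- The set of elements of `S` that fix each of the points `a 0, …, a (n - 1)`
(the action of `G` on `Fin n → X` is the coordinatewise one). -/
def stabIn {n : ℕ} (S : Set G) (a : Fin n → X) : Set G :=
  (MulAction.stabilizer G a : Set G) ∩ S

/-- The `n`-tuples of elements of `A` whose stabiliser in the subgroup generated by `S` has at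
least `|A| ^ t` elements. The stabiliser may be infinite, and then it counts as large. -/
def largeStabTuples (n : ℕ) (t : ℝ) (S : Finset G) (A : Finset X) : Set (Fin n → X) :=
  {a | (∀ i, a i ∈ A) ∧
    ((stabIn (Subgroup.closure (S : Set G) : Set G) a).Infinite ∨
      (A.card : ℝ) ^ t ≤ ((stabIn (Subgroup.closure (S : Set G) : Set G) a).ncard : ℝ))}

/-- The incidences `s * a = b` with `s ∈ S` and `a, b ∈ A`. -/
def incidences (S : Finset G) (A : Finset X) : Set (G × X × X) :=
  {p | p.1 ∈ S ∧ p.2.1 ∈ A ∧ p.2.2 ∈ A ∧ p.1 • p.2.1 = p.2.2}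

end BSGAction

/-!
Write `N = |A|`, and call `g` *`K`-rich* if it sends at least `N / K` points of `A` into `A`. Below,
"large" means up to a factor `N ^ o(1)`. By the incidence hypothesis a large part `B₀` of `S` is
rich. By Cauchy–Schwarz many pairs of rich elements have a rich quotient
(`sq_card_le_mul_card_rich_pairs`), so a rich set `B` can be replaced by the set `P` of the popular
rich quotients `b⁻¹ * b'`. Since most `n`-tuples of `A` have a small stabiliser, a rich subset of
`⟨S⟩` has at most about `N ^ (n + t)` elements (`card_le_of_rich`). Hence, if the step is repeated,
after boundedly many steps `P` is no longer essentially larger than `B`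
(`hasStableRichSet_or_exists_large`). The quotients of many pairs of `B` then lie in a set of size
about `|B|`, and the Balog–Szemerédi–Gowers theorem together with Tao's argument on popular
quotients gives an approximate subgroup `H` of size about `|B|` with `B ∩ y H` large
(`exists_approximateSubgroup_of_popular_quotients`).

The link with `S` is kept through the iteration by the property `IsSpreadOver`: a subset of `B` of
density `λ` has a left translate that meets `S` in density about `λ`. This holds for `B₀ ⊆ S`, and
it passes from `B` to the popular quotients, because a subset of these contains, up to translation,
a comparably dense subset of `B`. Applied to `B ∩ y H` it shows that a translate of `H` contains a
large part of `S`.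

The set `T` consists of the points of `A` that many elements of `B ∩ y H` send into `A`. Every
point of `H • T` is sent into `y⁻¹ • A` by many elements of `H * H`, and double counting bounds
`|H • T|` by about `N` (`exists_small_product_set`).

Each step raises the losses in richness and spread to at most their fourth power, but the number of
steps depends only on `n`, `t` and `δ`. So `ε` can be chosen so small that they stay below the power
`Q = N ^ η` of `N` by which the sets would have to grow.
-/

/-! ### Double counting and popularity -/

section Counting

open Finset

/-- Double counting in the form used below: if `f` has at least `m` preimages in `Q` over every
point of `Z`, exhibited by an injective family `φ`, then `m * #Z ≤ #Q`. -/
lemma mul_card_le_card_of_fibers {α β ι : Type*} {Z : Finset α} {Q : Finset β} (f : β → α) {m : ℝ}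
    (h : ∀ z ∈ Z, ∃ (I : Finset ι) (φ : ι → β), m ≤ #I ∧ Set.InjOn φ I ∧
      ∀ i ∈ I, φ i ∈ Q ∧ f (φ i) = z) :
    m * #Z ≤ #Q := by
  classical
  have h1 : ∀ z ∈ Z, m ≤ (#{q ∈ Q | f q = z} : ℝ) := by
    intro z hz
    obtain ⟨I, φ, hm, hinj, hφ⟩ := h z hz
    refine hm.trans ?_
    rw [← card_image_of_injOn hinj]
    refine mod_cast card_le_card ?_
    intro q hq
    obtain ⟨i, hi, rfl⟩ := mem_image.1 hq
    exact mem_filter.2 (hφ i hi)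
  calc m * #Z = ∑ z ∈ Z, m := by simp [mul_comm]
    _ ≤ ∑ z ∈ Z, (#{q ∈ Q | f q = z} : ℝ) := sum_le_sum h1
    _ = (#{q ∈ Q | f q ∈ Z} : ℝ) := by
        norm_cast
        rw [card_eq_sum_card_fiberwise (s := {q ∈ Q | f q ∈ Z}) (f := f) (t := Z)
          (fun q hq ↦ (mem_filter.1 hq).2)]
        refine sum_congr rfl fun z hz ↦ ?_
        rw [filter_filter]
        congr 1
        ext q
        simp only [mem_filter]
        constructor
        · rintro ⟨h1, h2⟩; exact ⟨h1, h2 ▸ hz, h2⟩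
        · rintro ⟨h1, -, h2⟩; exact ⟨h1, h2⟩
    _ ≤ #Q := mod_cast card_le_card (filter_subset _ _)

/-- Cauchy–Schwarz for a bipartite graph: degrees that are large on average force codegrees that are
large on average. -/
lemma sq_sum_degree_le_mul_sum_codegree {α β : Type*} (B : Finset α) (A : Finset β)
    (r : α → β → Prop) [∀ a b, Decidable (r a b)] :
    (∑ b ∈ B, (#{c ∈ A | r b c} : ℝ)) ^ 2 ≤
      #A * ∑ p ∈ B ×ˢ B, (#{c ∈ A | r p.1 c ∧ r p.2 c} : ℝ) := by
  have h1 : ∑ b ∈ B, (#{c ∈ A | r b c} : ℝ) = ∑ c ∈ A, (#{b ∈ B | r b c} : ℝ) := by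
    exact_mod_cast sum_card_bipartiteAbove_eq_sum_card_bipartiteBelow (s := B) (t := A) r
  have h2 : ∑ p ∈ B ×ˢ B, (#{c ∈ A | r p.1 c ∧ r p.2 c} : ℝ) =
      ∑ c ∈ A, (#{b ∈ B | r b c} : ℝ) ^ 2 := by
    norm_cast
    refine (sum_card_bipartiteAbove_eq_sum_card_bipartiteBelow (s := B ×ˢ B) (t := A)
      (fun p c ↦ r p.1 c ∧ r p.2 c)).trans ?_
    refine sum_congr rfl fun c _ ↦ ?_
    rw [sq, ← card_product, ← filter_product]
    rfl
  rw [h1, h2]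
  exact sq_sum_le_card_mul_sum_sq

/-- If values bounded by `N` have mean at least `N / k`, then a proportion at least `1 / (2 k)` of
them is at least `N / (2 k)`. -/
lemma card_le_mul_card_popular {ι : Type*} (s : Finset ι) (f : ι → ℝ) {N k : ℝ} (hN : 0 < N)
    (hk : 0 < k) (hf : ∀ i ∈ s, f i ≤ N) (hs : N * #s ≤ k * ∑ i ∈ s, f i)
    [DecidablePred fun i ↦ N ≤ 2 * k * f i] :
    (#s : ℝ) ≤ 2 * k * #{i ∈ s | N ≤ 2 * k * f i} := by
  set P := {i ∈ s | N ≤ 2 * k * f i}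
  have h0 := sum_filter_add_sum_filter_not s (fun i ↦ N ≤ 2 * k * f i) f
  have h1 : ∑ i ∈ s with N ≤ 2 * k * f i, f i ≤ #P * N := by
    have := sum_le_card_nsmul P f N fun i hi ↦ hf i (mem_of_mem_filter i hi)
    simpa using this
  have h2 : 2 * k * ∑ i ∈ s with ¬ N ≤ 2 * k * f i, f i ≤ #s * N := by
    rw [mul_sum]
    have := sum_le_card_nsmul {i ∈ s | ¬ N ≤ 2 * k * f i} (fun i ↦ 2 * k * f i) N
      fun i hi ↦ (not_le.1 (mem_filter.1 hi).2).le
    refine this.trans ?_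
    rw [nsmul_eq_mul]
    gcongr
    exact filter_subset _ _
  have h3 : 2 * k * ∑ i ∈ s with N ≤ 2 * k * f i, f i ≤ 2 * k * (#P * N) := by gcongr
  have h4 : N * #s ≤ N * (2 * k * #P) := by
    nlinarith [h0]
  exact le_of_mul_le_mul_left h4 hN

/-- A popularity threshold `R` such that the values of `f` taken at least `R` times account for `#Γ`
up to a logarithm, even if each of them is counted only `R` times. If no threshold worked, then
`#Γ = ∑ R, #{y | y is taken at least R times}` would be less than a harmonic sum allows. -/
lemma exists_popular_values {α β : Type*} [DecidableEq β] (Γ : Finset α) (f : α → β) (m : ℕ)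
    (hm : ∀ y, #{x ∈ Γ | f x = y} ≤ m) (hΓ : Γ.Nonempty) :
    ∃ (R : ℕ) (P : Finset β), 0 < R ∧ P ⊆ Γ.image f ∧
      (∀ y ∈ P, R ≤ #{x ∈ Γ | f x = y}) ∧ (#Γ : ℝ) ≤ (1 + Real.log m) * (R * #P) := by
  by_contra! hcon
  have hlt : ∀ R ∈ Icc 1 m, (1 + Real.log m) * #{y ∈ Γ.image f | R ≤ #{x ∈ Γ | f x = y}} <
      #Γ * (R : ℝ)⁻¹ := by
    intro R hR
    have hR0 : 0 < R := (mem_Icc.1 hR).1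
    have := hcon R {y ∈ Γ.image f | R ≤ #{x ∈ Γ | f x = y}} hR0 (filter_subset _ _)
      fun y hy ↦ (mem_filter.1 hy).2
    rw [← div_eq_mul_inv, lt_div_iff₀ (by exact_mod_cast hR0)]
    linarith
  obtain ⟨x₀, hx₀⟩ := hΓ
  have hfx₀ : 0 < #{x ∈ Γ | f x = f x₀} := card_pos.2 ⟨x₀, mem_filter.2 ⟨hx₀, rfl⟩⟩
  have hm1 : 1 ≤ m := hfx₀.trans_le (hm (f x₀))
  have hsum : (#Γ : ℝ) = ∑ R ∈ Icc 1 m, (#{y ∈ Γ.image f | R ≤ #{x ∈ Γ | f x = y}} : ℝ) := by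
    norm_cast
    rw [card_eq_sum_card_image f Γ]
    have := sum_card_bipartiteAbove_eq_sum_card_bipartiteBelow (s := Γ.image f) (t := Icc 1 m)
      (fun y R ↦ R ≤ #{x ∈ Γ | f x = y})
    refine Eq.trans (sum_congr rfl fun y _ ↦ ?_) this
    have : bipartiteAbove (fun y R ↦ R ≤ #{x ∈ Γ | f x = y}) (Icc 1 m) y =
        Icc 1 #{x ∈ Γ | f x = y} := by
      ext R
      have := hm y
      simp only [mem_bipartiteAbove, mem_Icc]
      omega
    rw [this]; simp
  have h1 : (1 + Real.log m) * #Γ < #Γ * ∑ R ∈ Icc 1 m, (R : ℝ)⁻¹ := by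
    rw [hsum, mul_sum, ← hsum, mul_sum]
    exact sum_lt_sum_of_nonempty ⟨1, by simp [hm1]⟩ hlt
  have h2 : ∑ R ∈ Icc 1 m, (R : ℝ)⁻¹ ≤ 1 + Real.log m := by
    have := harmonic_le_one_add_log m
    rw [harmonic_eq_sum_Icc] at this
    push_cast at this
    exact this
  nlinarith [(Nat.cast_nonneg #Γ : (0:ℝ) ≤ #Γ)]

end Counting

/-! ### Rich elements and their quotients -/

section Overlap

open Finset

variable {G X : Type*} [Group G] [MulAction G X] [DecidableEq X]

/-- The number of points of `A` that `g` sends into `A`. -/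
def overlap (A : Finset X) (g : G) : ℕ := #{a ∈ A | g • a ∈ A}

lemma overlap_le (A : Finset X) (g : G) : overlap A g ≤ #A := card_filter_le _ _

lemma overlap_inv (A : Finset X) (g : G) : overlap A g⁻¹ = overlap A g := by
  refine card_bij' (fun a _ ↦ g⁻¹ • a) (fun a _ ↦ g • a) ?_ ?_ ?_ ?_ <;>
    simp +contextual

/-- Quotients of elements with large overlap often have large overlap: by Cauchy–Schwarz the sets
`b • A ∩ A` and `b' • A ∩ A` often meet in many points, which `b'⁻¹` sends to points of `A` that
`b⁻¹ * b'` keeps in `A`. -/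
lemma sq_card_le_mul_card_rich_pairs (A : Finset X) (hA : A.Nonempty) (B : Finset G) {K : ℝ}
    (hK : 0 < K) (hB : ∀ b ∈ B, (#A : ℝ) ≤ K * overlap A b) :
    (#B : ℝ) ^ 2 ≤ 2 * K ^ 2 *
      #{p ∈ B ×ˢ B | (#A : ℝ) ≤ 2 * K ^ 2 * overlap A (p.1⁻¹ * p.2)} := by
  have hN : (0 : ℝ) < #A := by exact_mod_cast hA.card_pos
  have h := sq_sum_degree_le_mul_sum_codegree B A (fun b c ↦ b⁻¹ • c ∈ A)
  have h1 : (#A : ℝ) * #B ≤ K * ∑ b ∈ B, (#{c ∈ A | b⁻¹ • c ∈ A} : ℝ) := by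
    rw [mul_sum, mul_comm, ← nsmul_eq_mul]
    refine card_nsmul_le_sum _ _ _ fun b hb ↦ ?_
    have := hB b hb
    rwa [← overlap_inv] at this
  have h2 : ∑ p ∈ B ×ˢ B, (#{c ∈ A | p.1⁻¹ • c ∈ A ∧ p.2⁻¹ • c ∈ A} : ℝ) ≤
      ∑ p ∈ B ×ˢ B, (overlap A (p.1⁻¹ * p.2) : ℝ) := by
    refine sum_le_sum fun p _ ↦ ?_
    norm_cast
    refine card_le_card_of_injOn (fun c ↦ p.2⁻¹ • c) ?_ (MulAction.injective _).injOn
    intro c hc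
    simp only [coe_filter, Set.mem_ofPred_eq] at hc ⊢
    exact ⟨hc.2.2, by simpa [mul_smul] using hc.2.1⟩
  have h3 : (#A : ℝ) * #(B ×ˢ B) ≤
      K ^ 2 * ∑ p ∈ B ×ˢ B, (overlap A (p.1⁻¹ * p.2) : ℝ) := by
    have h4 : ((#A : ℝ) * #B) ^ 2 ≤ K ^ 2 * (#A * ∑ p ∈ B ×ˢ B,
        (overlap A (p.1⁻¹ * p.2) : ℝ)) := by
      calc _ ≤ (K * ∑ b ∈ B, (#{c ∈ A | b⁻¹ • c ∈ A} : ℝ)) ^ 2 := by gcongr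
        _ ≤ K ^ 2 * (#A * ∑ p ∈ B ×ˢ B, (#{c ∈ A | p.1⁻¹ • c ∈ A ∧ p.2⁻¹ • c ∈ A} : ℝ)) := by
            rw [mul_pow]; gcongr
        _ ≤ _ := by gcongr
    rw [card_product]
    push_cast
    refine le_of_mul_le_mul_left ?_ hN
    linarith
  have h5 := card_le_mul_card_popular (B ×ˢ B) (k := K ^ 2)
    (fun p ↦ (overlap A (p.1⁻¹ * p.2) : ℝ)) hN (by positivity)
    (fun p _ ↦ Nat.cast_le.2 (overlap_le A (p.1⁻¹ * p.2))) h3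
  rw [card_product] at h5
  push_cast at h5
  rwa [sq]

end Overlap

/-! ### The Balog–Szemerédi–Gowers theorem and approximate subgroups -/

section BalogSzemerediGowers

open Finset

/-- Dependent random choice: some neighbourhood in a dense bipartite graph is large, and most pairs
of its points have many common neighbours. -/
lemma exists_subset_few_bad_pairs {α : Type*} (B : Finset α) (hB : B.Nonempty)
    (r : α → α → Prop) [∀ a b, Decidable (r a b)] {L : ℝ} (hL : 0 < L)
    (hr : (#B : ℝ) ^ 2 ≤ L * ∑ c ∈ B, (#{b ∈ B | r c b} : ℝ)) :
    ∃ N ⊆ B, #B ≤ 2 * L * #N ∧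
      16 * (#{p ∈ N ×ˢ N | ¬ #B ≤ 32 * L ^ 2 * (#{c ∈ B | r c p.1 ∧ r c p.2} : ℝ)} : ℝ) ≤
        (#N : ℝ) ^ 2 := by
  have hB0 : (0 : ℝ) < #B := by exact_mod_cast hB.card_pos
  set w : α × α → ℝ := fun p ↦ (#{c ∈ B | r c p.1 ∧ r c p.2} : ℝ) with hw
  set N : α → Finset α := fun c ↦ {b ∈ B | r c b} with hN
  set bad : Finset (α × α) := {p ∈ B ×ˢ B | ¬ #B ≤ 32 * L ^ 2 * w p} with hbad
  have hS : (#B : ℝ) ^ 3 ≤ L ^ 2 * ∑ c ∈ B, (#(N c) : ℝ) ^ 2 := by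
    have h1 : (∑ c ∈ B, (#(N c) : ℝ)) ^ 2 ≤ #B * ∑ c ∈ B, (#(N c) : ℝ) ^ 2 :=
      sq_sum_le_card_mul_sum_sq
    have h2 : ((#B : ℝ) ^ 2) ^ 2 ≤ (L * ∑ c ∈ B, (#(N c) : ℝ)) ^ 2 := by gcongr
    refine le_of_mul_le_mul_left ?_ hB0
    calc (#B : ℝ) * #B ^ 3 = (#B ^ 2) ^ 2 := by ring
      _ ≤ L ^ 2 * (∑ c ∈ B, (#(N c) : ℝ)) ^ 2 := by rwa [← mul_pow]
      _ ≤ L ^ 2 * (#B * ∑ c ∈ B, (#(N c) : ℝ) ^ 2) := by gcongr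
      _ = _ := by ring
  -- Each bad pair lies in few neighbourhoods.
  have hbadsum : 32 * L ^ 2 * ∑ c ∈ B, (#{p ∈ bad | r c p.1 ∧ r c p.2} : ℝ) ≤ #B ^ 3 := by
    have h1 : ∑ c ∈ B, (#{p ∈ bad | r c p.1 ∧ r c p.2} : ℝ) = ∑ p ∈ bad, w p := by
      simp only [hw]
      exact_mod_cast sum_card_bipartiteAbove_eq_sum_card_bipartiteBelow (s := B) (t := bad)
        (fun c p ↦ r c p.1 ∧ r c p.2)
    rw [h1, mul_sum]
    have h2 := sum_le_card_nsmul bad (fun p ↦ 32 * L ^ 2 * w p) (#B : ℝ)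
      fun p hp ↦ (not_le.1 (mem_filter.1 hp).2).le
    have h3 : (#bad : ℝ) ≤ #B * #B := by
      rw [← Nat.cast_mul, ← card_product]
      exact_mod_cast card_filter_le _ _
    calc _ ≤ (#bad : ℝ) * #B := by simpa using h2
      _ ≤ #B * #B * #B := by gcongr
      _ = _ := by ring
  obtain ⟨c, hc, hcc⟩ : ∃ c ∈ B, (#B : ℝ) ^ 2 / (2 * L ^ 2) ≤
      (#(N c) : ℝ) ^ 2 - 16 * (#{p ∈ bad | r c p.1 ∧ r c p.2} : ℝ) := by
    refine exists_le_of_sum_le hB ?_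
    rw [sum_const, nsmul_eq_mul, sum_sub_distrib, ← mul_sum, ← mul_div_assoc, div_le_iff₀
      (by positivity)]
    nlinarith
  refine ⟨N c, filter_subset _ _, ?_, ?_⟩
  · have h1 : (#B : ℝ) ^ 2 ≤ (2 * L * #(N c)) ^ 2 := by
      rw [div_le_iff₀ (by positivity)] at hcc
      have : (0 : ℝ) ≤ #{p ∈ bad | r c p.1 ∧ r c p.2} := Nat.cast_nonneg _
      have h3 : 0 ≤ 16 * (#{p ∈ bad | r c p.1 ∧ r c p.2} : ℝ) * (2 * L ^ 2) := by positivity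
      have h4 : 0 ≤ 2 * (L * #(N c) : ℝ) ^ 2 := by positivity
      nlinarith
    exact le_of_sq_le_sq h1 (by positivity)
  · have h1 : (0 : ℝ) ≤ (#B : ℝ) ^ 2 / (2 * L ^ 2) := by positivity
    have h2 : {p ∈ N c ×ˢ N c | ¬ #B ≤ 32 * L ^ 2 * w p} ⊆ {p ∈ bad | r c p.1 ∧ r c p.2} := by
      intro p hp
      simp only [hN, hbad, mem_filter, mem_product] at hp ⊢
      tauto
    have h3 : (#{p ∈ N c ×ˢ N c | ¬ #B ≤ 32 * L ^ 2 * w p} : ℝ) ≤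
        #{p ∈ bad | r c p.1 ∧ r c p.2} := by exact_mod_cast card_le_card h2
    linarith

variable {G : Type*} [Group G] [DecidableEq G]

/-- The Balog–Szemerédi–Gowers theorem for quotients `b⁻¹ * b'` in an arbitrary group. All constants
are absorbed into powers of `L`, which is why `2 ≤ L` is assumed. -/
lemma exists_subset_small_quotient_set (B : Finset G) (hB : B.Nonempty) (Γ : Finset (G × G))
    (hΓB : Γ ⊆ B ×ˢ B) (P : Finset G) (hP : ∀ p ∈ Γ, p.1⁻¹ * p.2 ∈ P) {L : ℝ} (hL : 2 ≤ L)
    (hΓ : (#B : ℝ) ^ 2 ≤ L * #Γ) (hPB : (#P : ℝ) ≤ L * #B) :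
    ∃ C ⊆ B, C.Nonempty ∧ (#B : ℝ) ≤ L ^ 3 * #C ∧ (#(C⁻¹ * C) : ℝ) ≤ L ^ 21 * #B := by
  have hB0 : (0 : ℝ) < #B := by exact_mod_cast hB.card_pos
  have hL0 : 0 < L := by linarith
  have hdeg : (#Γ : ℝ) = ∑ c ∈ B, (#{b ∈ B | (c, b) ∈ Γ} : ℝ) := by
    norm_cast
    rw [card_eq_sum_card_fiberwise (f := Prod.fst) (t := B)
      (fun p hp ↦ (mem_product.1 (hΓB hp)).1)]
    refine sum_congr rfl fun c hc ↦ ?_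
    refine card_bij' (fun p _ ↦ p.2) (fun b _ ↦ (c, b)) ?_ ?_ ?_ ?_
    · rintro ⟨x, y⟩ h
      obtain ⟨h1, rfl⟩ := mem_filter.1 h
      exact mem_filter.2 ⟨(mem_product.1 (hΓB h1)).2, h1⟩
    · intro b hb
      exact mem_filter.2 ⟨(mem_filter.1 hb).2, rfl⟩
    · rintro ⟨x, y⟩ h
      obtain ⟨h1, rfl⟩ := mem_filter.1 h
      rfl
    · intro b hb; rfl
  rw [hdeg] at hΓ
  obtain ⟨N, hNB, hN, hbad⟩ := exists_subset_few_bad_pairs B hB (fun c b ↦ (c, b) ∈ Γ) hL0 hΓ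
  set w : G → G → Finset G := fun x y ↦ {c ∈ B | (c, x) ∈ Γ ∧ (c, y) ∈ Γ} with hw
  have hN0 : (0 : ℝ) < #N := by
    by_contra! h
    have h' : (#N : ℝ) = 0 := le_antisymm h (Nat.cast_nonneg _)
    rw [h', mul_zero] at hN
    linarith
  let bad : G → Finset G := fun b ↦ {c ∈ N | ¬ #B ≤ 32 * L ^ 2 * (#(w b c) : ℝ)}
  -- Any two points of `C` have good pairs with at least half of the points `c` of `N` in common.
  set C : Finset G := {b ∈ N | 4 * (#(bad b) : ℝ) ≤ #N} with hC
  have hbadsum : (#{p ∈ N ×ˢ N | ¬ #B ≤ 32 * L ^ 2 * (#(w p.1 p.2) : ℝ)} : ℝ) =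
      ∑ b ∈ N, (#(bad b) : ℝ) := by
    norm_cast
    rw [card_filter, sum_product]
    refine sum_congr rfl fun b _ ↦ ?_
    rw [card_filter]
  have hCN : (#N : ℝ) ≤ 2 * #C := by
    have h1 : (#C : ℝ) + #{b ∈ N | ¬ 4 * (#(bad b) : ℝ) ≤ #N} = #N := by
      rw [← Nat.cast_add]
      exact congrArg _ (card_filter_add_card_filter_not (s := N)
        (fun b ↦ 4 * (#(bad b) : ℝ) ≤ #N))
    have h2 := card_nsmul_le_sum {b ∈ N | ¬ 4 * (#(bad b) : ℝ) ≤ #N}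
      (fun b ↦ 4 * (#(bad b) : ℝ)) (#N : ℝ) fun b hb ↦ (not_le.1 (mem_filter.1 hb).2).le
    have h3 : ∑ b ∈ N with ¬ 4 * (#(bad b) : ℝ) ≤ #N, 4 * (#(bad b) : ℝ) ≤
        ∑ b ∈ N, 4 * (#(bad b) : ℝ) :=
      sum_le_sum_of_subset_of_nonneg (filter_subset _ _) fun _ _ _ ↦ by positivity
    rw [← mul_sum (s := N), ← hbadsum] at h3
    rw [nsmul_eq_mul] at h2
    have h4 : (#{b ∈ N | ¬ 4 * (#(bad b) : ℝ) ≤ #N} : ℝ) * 4 ≤ #N := by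
      refine le_of_mul_le_mul_right ?_ hN0
      linarith
    linarith
  have hC0 : (0 : ℝ) < #C := by linarith
  refine ⟨C, (filter_subset _ _).trans hNB, card_pos.1 (by exact_mod_cast hC0), ?_, ?_⟩
  · calc (#B : ℝ) ≤ 2 * L * (2 * #C) := by
          refine hN.trans ?_
          gcongr
      _ = L * (2 * 2) * #C := by ring
      _ ≤ L * (L * L) * #C := by gcongr
      _ = _ := by ring
  -- An element `b₁⁻¹ * b₂` of `C⁻¹ * C` factors as `(d⁻¹ b₁)⁻¹ (d⁻¹ c) (e⁻¹ c)⁻¹ (e⁻¹ b₂)`.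
  have key := mul_card_le_card_of_fibers (Z := C⁻¹ * C) (Q := (P ×ˢ P) ×ˢ (P ×ˢ P))
    (ι := Σ _ : G, G × G) (fun q ↦ q.1.1⁻¹ * q.1.2 * q.2.1⁻¹ * q.2.2)
    (m := #N / 2 * ((#B / (32 * L ^ 2)) * (#B / (32 * L ^ 2)))) ?_
  · rw [card_product, card_product] at key
    push_cast at key
    have h1 : (#P : ℝ) * #P * (#P * #P) ≤ (L * #B) * (L * #B) * ((L * #B) * (L * #B)) := by
      gcongr
    have h2 := key.trans h1
    have h3 : (#B : ℝ) / (4 * L) ≤ #N / 2 := by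
      rw [div_le_iff₀ (by positivity)]; linarith
    have h4 : (#B : ℝ) / (4 * L) * ((#B / (32 * L ^ 2)) * (#B / (32 * L ^ 2))) *
        #(C⁻¹ * C) ≤ (L * #B) * (L * #B) * ((L * #B) * (L * #B)) := by
      refine le_trans ?_ h2
      gcongr
    have h5 : (#(C⁻¹ * C) : ℝ) ≤ 2 ^ 12 * L ^ 9 * #B := by
      have e : (#B : ℝ) / (4 * L) * ((#B / (32 * L ^ 2)) * (#B / (32 * L ^ 2))) *
        #(C⁻¹ * C) = (#B : ℝ) ^ 3 * #(C⁻¹ * C) / (2 ^ 12 * L ^ 5) := by field_simp; ring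
      rw [e, div_le_iff₀ (by positivity)] at h4
      refine le_of_mul_le_mul_left ?_ (pow_pos hB0 3)
      calc _ ≤ _ := h4
        _ = _ := by ring
    calc _ ≤ _ := h5
      _ ≤ L ^ 12 * L ^ 9 * #B := by gcongr
      _ = _ := by ring
  · intro z hz
    obtain ⟨x, hx, b₂, hb₂, rfl⟩ := mem_mul.1 hz
    obtain ⟨b₁, hb₁, rfl⟩ := mem_inv.1 hx
    set I : Finset G := {c ∈ N | #B ≤ 32 * L ^ 2 * (#(w b₁ c) : ℝ) ∧
      #B ≤ 32 * L ^ 2 * (#(w b₂ c) : ℝ)} with hI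
    refine ⟨I.sigma fun c ↦ w b₁ c ×ˢ w b₂ c,
      fun i ↦ ((i.2.1⁻¹ * b₁, i.2.1⁻¹ * i.1), (i.2.2⁻¹ * i.1, i.2.2⁻¹ * b₂)), ?_, ?_, ?_⟩
    · have hIcard : (#N : ℝ) / 2 ≤ #I := by
        have h1 : N ⊆ I ∪ (bad b₁ ∪ bad b₂) := by
          intro c hc
          simp only [hI, bad, mem_union, mem_filter]
          tauto
        have h2 : (#N : ℝ) ≤ #I + (#(bad b₁) + #(bad b₂)) := by
          exact_mod_cast (card_le_card h1).trans ((card_union_le _ _).trans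
            (by gcongr; exact card_union_le _ _))
        have h3 := (mem_filter.1 hb₁).2
        have h4 := (mem_filter.1 hb₂).2
        linarith
      rw [card_sigma]
      push_cast
      calc _ ≤ (#I : ℝ) * ((#B / (32 * L ^ 2)) * (#B / (32 * L ^ 2))) := by gcongr
        _ ≤ _ := by
          rw [← nsmul_eq_mul]
          refine card_nsmul_le_sum _ _ _ fun c hc ↦ ?_
          rw [card_product]
          push_cast
          obtain ⟨-, h1, h2⟩ := mem_filter.1 hc
          gcongr
          · rwa [div_le_iff₀' (by positivity)]
          · rwa [div_le_iff₀' (by positivity)]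
    · rintro ⟨c, d, e⟩ - ⟨c', d', e'⟩ - h
      simp only [Prod.mk.injEq, mul_left_inj, inv_inj] at h
      obtain ⟨⟨rfl, h1⟩, -, rfl⟩ := h
      obtain rfl := mul_left_cancel h1
      rfl
    · rintro ⟨c, d, e⟩ hi
      simp only [mem_sigma, mem_product, hw, mem_filter] at hi
      obtain ⟨-, ⟨-, h1, h2⟩, -, h3, h4⟩ := hi
      refine ⟨?_, by simp [mul_assoc]⟩
      simp only [mem_product]
      exact ⟨⟨hP _ h1, hP _ h2⟩, hP _ h4, hP _ h3⟩

/-- If the quotients `u⁻¹ * v` of elements of `C` take few values, then the quotients `v * u⁻¹` have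
many representations on average. -/
lemma card_mul_card_le_sum_overlap (C : Finset G) (hC : C.Nonempty) {M : ℝ}
    (hM : (#(C⁻¹ * C) : ℝ) ≤ M * #C) :
    (#C : ℝ) * #(C ×ˢ C) ≤ M * ∑ p ∈ C ×ˢ C, (overlap C (p.2 * p.1⁻¹) : ℝ) := by
  have hC0 : (0 : ℝ) < #C := by exact_mod_cast hC.card_pos
  have hM0 : 0 ≤ M * #C := le_trans (by positivity) hM
  have h := sq_sum_degree_le_mul_sum_codegree C (C⁻¹ * C) (fun u x ↦ u * x ∈ C)
  have h1 : ∑ u ∈ C, (#{x ∈ C⁻¹ * C | u * x ∈ C} : ℝ) = #C * #C := by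
    rw [← nsmul_eq_mul]
    refine sum_eq_card_nsmul fun u hu ↦ ?_
    norm_cast
    refine card_bij' (fun x _ ↦ u * x) (fun v _ ↦ u⁻¹ * v) ?_ ?_ ?_ ?_
    · intro x hx; exact (mem_filter.1 hx).2
    · intro v hv
      refine mem_filter.2 ⟨mul_mem_mul (inv_mem_inv hu) hv, by simpa using hv⟩
    · intro x _; simp
    · intro v _; simp
  have h2 : ∑ p ∈ C ×ˢ C, (#{x ∈ C⁻¹ * C | p.1 * x ∈ C ∧ p.2 * x ∈ C} : ℝ) ≤
      ∑ p ∈ C ×ˢ C, (overlap C (p.2 * p.1⁻¹) : ℝ) := by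
    refine sum_le_sum fun p _ ↦ ?_
    norm_cast
    refine card_le_card_of_injOn (fun x ↦ p.1 * x) ?_ (mul_right_injective p.1).injOn
    intro x hx
    simp only [coe_filter, Set.mem_ofPred_eq] at hx ⊢
    exact ⟨hx.2.1, by simpa using hx.2.2⟩
  rw [h1] at h
  rw [card_product]
  push_cast
  refine le_of_mul_le_mul_left ?_ hC0
  have h3 := h.trans (mul_le_mul hM h2 (by positivity) (by positivity))
  linarith

/-- A set `C` with small `C⁻¹ * C` has a large part in a left coset of an approximate subgroup. It
comes from the popular elements of `C * C⁻¹`, a set of small tripling; conjugation turns the right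
coset `H * y` into the left coset `y * (y⁻¹ * H * y)`. -/
lemma exists_approximateSubgroup_of_small_quotient_set (C : Finset G) (hC : C.Nonempty) {M : ℝ}
    (hM1 : 1 ≤ M) (hM : (#(C⁻¹ * C) : ℝ) ≤ M * #C) :
    ∃ (H : Finset G) (y : G), IsApproximateSubgroup ((16 * M ^ 8) ^ 3) (H : Set G) ∧
      (#H : ℝ) ≤ 8 * M ^ 7 * #C ∧ (#C : ℝ) ≤ 2 * M * #{c ∈ C | y⁻¹ * c ∈ H} := by
  have hC0 : (0 : ℝ) < #C := by exact_mod_cast hC.card_pos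
  have hM0 : 0 < M := by linarith
  set S : Finset G := {x ∈ C * C⁻¹ | (#C : ℝ) ≤ 2 * M * overlap C x} with hS
  have henergy := card_mul_card_le_sum_overlap C hC hM
  have hpop := card_le_mul_card_popular (C ×ˢ C) (k := M)
    (fun p ↦ (overlap C (p.2 * p.1⁻¹) : ℝ)) hC0 hM0
    (fun p _ ↦ Nat.cast_le.2 (overlap_le C (p.2 * p.1⁻¹))) henergy
  have hpop' : (#C : ℝ) * #C ≤ 2 * M * ∑ y ∈ C, (#{c ∈ C | c * y⁻¹ ∈ S} : ℝ) := by
    rw [card_product] at hpop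
    push_cast at hpop
    refine hpop.trans ?_
    gcongr
    norm_cast
    rw [card_filter, sum_product]
    refine sum_le_sum fun y hy ↦ ?_
    rw [← card_filter]
    refine card_le_card fun c hc ↦ ?_
    obtain ⟨h1, h2⟩ := mem_filter.1 hc
    exact mem_filter.2 ⟨h1, mem_filter.2 ⟨mul_mem_mul h1 (inv_mem_inv hy), h2⟩⟩
  obtain ⟨y, hy, hyS⟩ : ∃ y ∈ C, (#C : ℝ) ≤ 2 * M * #{c ∈ C | c * y⁻¹ ∈ S} := by
    refine exists_le_of_sum_le hC ?_
    rw [sum_const, nsmul_eq_mul, ← mul_sum]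
    exact hpop'
  have hScard : (#C : ℝ) ≤ 2 * M * #S := by
    have h1 : #{c ∈ C | c * y⁻¹ ∈ S} ≤ #S :=
      card_le_card_of_injOn (fun c ↦ c * y⁻¹) (fun c hc ↦ (mem_filter.1 hc).2)
        (mul_left_injective y⁻¹).injOn
    exact hyS.trans (by gcongr)
  have hone : 1 ∈ S := by
    refine mem_filter.2 ⟨mem_mul.2 ⟨y, hy, y⁻¹, inv_mem_inv hy, by simp⟩, ?_⟩
    have : overlap C (1 : G) = #C := by simp [overlap]
    rw [this]
    nlinarith
  have hsymm : S⁻¹ = S := by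
    ext x
    rw [mem_inv']
    simp only [hS, mem_filter, overlap_inv]
    rw [← mem_inv', mul_inv_rev, inv_inv]
  -- Triple products of `S` are conjugates of quadruple products in `C⁻¹ * C`.
  have htriple : (#(S ^ 3) : ℝ) ≤ 8 * M ^ 7 * #C := by
    have key := mul_card_le_card_of_fibers (Z := S ^ 3)
      (Q := ((C⁻¹ * C) ×ˢ (C⁻¹ * C)) ×ˢ ((C⁻¹ * C) ×ˢ (C⁻¹ * C)))
      (ι := (G × G) × G) (fun q ↦ y * (q.1.1 * q.1.2 * q.2.1 * q.2.2) * y⁻¹)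
      (m := (#C / (2 * M)) * (#C / (2 * M)) * (#C / (2 * M))) ?_
    · simp only [card_product] at key
      push_cast at key
      have h1 : (#(C⁻¹ * C) : ℝ) * #(C⁻¹ * C) * (#(C⁻¹ * C) * #(C⁻¹ * C)) ≤
          (M * #C) * (M * #C) * ((M * #C) * (M * #C)) := by gcongr
      have h2 := key.trans h1
      have e : (#C : ℝ) / (2 * M) * (#C / (2 * M)) * (#C / (2 * M)) * #(S ^ 3) =
        (#C : ℝ) ^ 3 * #(S ^ 3) / (8 * M ^ 3) := by field_simp; ring
      rw [e, div_le_iff₀ (by positivity)] at h2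
      refine le_of_mul_le_mul_left ?_ (pow_pos hC0 3)
      calc _ ≤ _ := h2
        _ = _ := by ring
    · intro z hz
      rw [pow_succ, sq] at hz
      obtain ⟨s, hs, s₃, hs₃, rfl⟩ := mem_mul.1 hz
      obtain ⟨s₁, hs₁, s₂, hs₂, rfl⟩ := mem_mul.1 hs
      refine ⟨({v ∈ C | s₁ • v ∈ C} ×ˢ {v ∈ C | s₂ • v ∈ C}) ×ˢ {v ∈ C | s₃ • v ∈ C},
        fun v ↦ ((y⁻¹ * (s₁ * v.1.1), v.1.1⁻¹ * (s₂ * v.1.2)),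
          (v.1.2⁻¹ * (s₃ * v.2), v.2⁻¹ * y)), ?_, ?_, ?_⟩
      · rw [card_product, card_product]
        push_cast
        have h1 := (mem_filter.1 hs₁).2
        have h2 := (mem_filter.1 hs₂).2
        have h3 := (mem_filter.1 hs₃).2
        unfold overlap at h1 h2 h3
        rw [← div_le_iff₀' (by positivity)] at h1 h2 h3
        gcongr
      · rintro ⟨⟨u, v⟩, x⟩ - ⟨⟨u', v'⟩, x'⟩ - h
        simp only [Prod.mk.injEq, mul_right_inj] at h
        obtain ⟨⟨rfl, h1⟩, h2, h3⟩ := h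
        simp only [mul_left_inj, inv_inj] at h3
        subst h3
        simp only [mul_right_inj] at h1
        subst h1
        rfl
      · rintro ⟨⟨u, v⟩, x⟩ hi
        simp only [mem_product, mem_filter, smul_eq_mul] at hi
        obtain ⟨⟨⟨h1, h2⟩, h3, h4⟩, h5, h6⟩ := hi
        refine ⟨?_, by simp; group⟩
        simp only [mem_product]
        exact ⟨⟨mul_mem_mul (inv_mem_inv hy) h2, mul_mem_mul (inv_mem_inv h1) h4⟩,
          mul_mem_mul (inv_mem_inv h3) h6, mul_mem_mul (inv_mem_inv h5) hy⟩
  have htrip : (#(S ^ 3) : ℝ) ≤ 16 * M ^ 8 * #S := by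
    calc _ ≤ _ := htriple
      _ ≤ 8 * M ^ 7 * (2 * M * #S) := by gcongr
      _ = _ := by ring
  have happ := IsApproximateSubgroup.of_small_tripling hone hsymm htrip
  refine ⟨(S ^ 2).image (MulAut.conj y⁻¹), y, ?_, ?_, ?_⟩
  · rw [coe_image, coe_pow]
    exact happ.image (MulAut.conj y⁻¹)
  · refine le_trans ?_ htriple
    refine mod_cast card_image_le.trans (card_le_card ?_)
    exact pow_subset_pow_right hone (by norm_num)
  · refine hyS.trans ?_
    gcongr with c hc
    intro h
    refine mem_image.2 ⟨c * y⁻¹, ?_, by simp [mul_assoc]⟩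
    rw [sq]
    exact mem_mul.2 ⟨_, h, 1, hone, by simp⟩

/-- If the quotients of many pairs of `B` lie in a set of size about `|B|`, then a large part of `B`
lies in a left coset of an approximate subgroup of size about `|B|`. The exponent `600` is a
convenient common bound for all the losses. -/
lemma exists_approximateSubgroup_of_popular_quotients (B : Finset G) (hB : B.Nonempty)
    (Γ : Finset (G × G)) (hΓB : Γ ⊆ B ×ˢ B) (P : Finset G) (hP : ∀ p ∈ Γ, p.1⁻¹ * p.2 ∈ P)
    {L : ℝ} (hL : 2 ≤ L) (hΓ : (#B : ℝ) ^ 2 ≤ L * #Γ) (hPB : (#P : ℝ) ≤ L * #B) :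
    ∃ (H : Finset G) (y : G), IsApproximateSubgroup (L ^ 600) (H : Set G) ∧
      (#H : ℝ) ≤ L ^ 600 * #B ∧ (#B : ℝ) ≤ L ^ 600 * #{b ∈ B | y⁻¹ * b ∈ H} := by
  obtain ⟨C, hCB, hC, hC1, hC2⟩ := exists_subset_small_quotient_set B hB Γ hΓB P hP hL hΓ hPB
  have hL0 : 0 < L := by linarith
  have hL1 : 1 ≤ L := by linarith
  have hC3 : (#(C⁻¹ * C) : ℝ) ≤ L ^ 24 * #C := by
    calc _ ≤ L ^ 21 * (L ^ 3 * #C) := hC2.trans (by gcongr)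
      _ = _ := by ring
  obtain ⟨H, y, h1, h2, h3⟩ :=
    exists_approximateSubgroup_of_small_quotient_set C hC (one_le_pow₀ hL1) hC3
  have hCBc : (#C : ℝ) ≤ #B := by exact_mod_cast card_le_card hCB
  refine ⟨H, y, h1.mono ?_, ?_, ?_⟩
  · calc (16 * (L ^ 24) ^ 8) ^ 3 = (2 ^ 4 * L ^ 192) ^ 3 := by norm_num [← pow_mul]
      _ ≤ (L ^ 4 * L ^ 192) ^ 3 := by gcongr
      _ = L ^ 588 := by rw [← pow_add, ← pow_mul]
      _ ≤ L ^ 600 := pow_le_pow_right₀ hL1 (by norm_num)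
  · calc (#H : ℝ) ≤ 2 ^ 3 * L ^ 168 * #C := by
          refine h2.trans_eq ?_
          rw [← pow_mul]; norm_num
      _ ≤ L ^ 3 * L ^ 168 * #B := by gcongr
      _ = L ^ 171 * #B := by rw [← pow_add]
      _ ≤ L ^ 600 * #B := by gcongr; norm_num
  · calc (#B : ℝ) ≤ L ^ 3 * (2 * L ^ 24 * #{c ∈ C | y⁻¹ * c ∈ H}) := hC1.trans (by gcongr)
      _ ≤ L ^ 3 * (L * L ^ 24 * #{c ∈ B | y⁻¹ * c ∈ H}) := by gcongr
      _ = L ^ 28 * #{c ∈ B | y⁻¹ * c ∈ H} := by ring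
      _ ≤ L ^ 600 * #{c ∈ B | y⁻¹ * c ∈ H} := by gcongr; norm_num

end BalogSzemerediGowers

/-! ### The number of rich elements, and sets of small expansion -/

section Rich

open Finset

variable {G X : Type*} [Group G] [MulAction G X] [DecidableEq X]

/-- Rich elements of `⟨S⟩` are few: each of them sends many `n`-tuples of `A` with small stabiliser
to `n`-tuples of `A`, and few elements agree on such a tuple. -/
lemma card_le_of_rich {n : ℕ} {t δ K : ℝ} (S : Finset G) (A : Finset X) (hA : A.Nonempty)
    (hbad : ((largeStabTuples n t S A).ncard : ℝ) ≤ (#A : ℝ) ^ ((n : ℝ) - δ))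
    (hK : 0 < K) (hKδ : 2 * K ^ n ≤ (#A : ℝ) ^ δ) (F : Finset G)
    (hFS : ∀ g ∈ F, g ∈ Subgroup.closure (S : Set G))
    (hF : ∀ g ∈ F, (#A : ℝ) ≤ K * overlap A g) :
    (#F : ℝ) ≤ 2 * K ^ n * (#A : ℝ) ^ ((n : ℝ) + t) := by
  classical
  have hN : (0 : ℝ) < #A := by exact_mod_cast hA.card_pos
  set An : Finset (Fin n → X) := Fintype.piFinset fun _ ↦ A with hAn
  have hAnc : #An = #A ^ n := by simp [hAn]
  set bad : Finset (Fin n → X) := {a ∈ An | a ∈ largeStabTuples n t S A} with hbadset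
  set good : Finset (Fin n → X) := {a ∈ An | a ∉ largeStabTuples n t S A} with hgood
  have hbadc : (#bad : ℝ) ≤ (#A : ℝ) ^ ((n : ℝ) - δ) := by
    have : (largeStabTuples n t S A) = (bad : Set (Fin n → X)) := by
      ext a
      simp only [hbadset, coe_filter, Set.mem_ofPred_eq, iff_and_self, hAn,
        Fintype.mem_piFinset]
      exact fun h ↦ h.1
    rwa [this, Set.ncard_coe_finset] at hbad
  set Ω : Finset (G × (Fin n → X)) := {p ∈ F ×ˢ good | p.1 • p.2 ∈ An} with hΩ
  have hlow : (#F : ℝ) * ((#A : ℝ) ^ n / (2 * K ^ n)) ≤ #Ω := by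
    have h1 : (#Ω : ℝ) = ∑ g ∈ F, (#{a ∈ good | g • a ∈ An} : ℝ) := by
      norm_cast
      rw [hΩ, card_filter, sum_product]
      exact sum_congr rfl fun g _ ↦ (card_filter _ _).symm
    rw [h1, ← nsmul_eq_mul]
    refine card_nsmul_le_sum _ _ _ fun g hg ↦ ?_
    have h2 : {a ∈ An | g • a ∈ An} = Fintype.piFinset fun _ : Fin n ↦ {a ∈ A | g • a ∈ A} := by
      ext a
      simp [hAn, forall_and]
    have h3 : #{a ∈ An | g • a ∈ An} = overlap A g ^ n := by
      rw [h2]; simp [overlap]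
    have h4 : (overlap A g : ℝ) ^ n ≤ #{a ∈ good | g • a ∈ An} + #bad := by
      rw [← Nat.cast_pow, ← h3, ← Nat.cast_add, Nat.cast_le]
      refine (card_le_card fun a ha ↦ ?_).trans (card_union_le _ _)
      simp only [hgood, hbadset, mem_union, mem_filter] at ha ⊢
      tauto
    have h5 : (#A : ℝ) ^ n / K ^ n ≤ (overlap A g : ℝ) ^ n := by
      rw [div_le_iff₀ (by positivity), ← mul_pow]
      have := hF g hg
      gcongr
      linarith
    have h6 : (#A : ℝ) ^ ((n : ℝ) - δ) ≤ (#A : ℝ) ^ n / (2 * K ^ n) := by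
      rw [Real.rpow_sub hN, Real.rpow_natCast]
      gcongr
    have h7 : (#A : ℝ) ^ n / K ^ n = 2 * ((#A : ℝ) ^ n / (2 * K ^ n)) := by
      field_simp
    linarith
  have hup : (#Ω : ℝ) ≤ (#A : ℝ) ^ n * (#A : ℝ) ^ n * (#A : ℝ) ^ t := by
    have hmaps : ∀ p ∈ Ω, (p.2, p.1 • p.2) ∈ An ×ˢ An := by
      intro p hp
      obtain ⟨h1, h2⟩ := mem_filter.1 hp
      exact mem_product.2 ⟨(mem_filter.1 (mem_product.1 h1).2).1, h2⟩
    rw [card_eq_sum_card_fiberwise hmaps]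
    push_cast
    have h1 := sum_le_card_nsmul (An ×ˢ An)
      (fun q ↦ (#{p ∈ Ω | (p.2, p.1 • p.2) = q} : ℝ)) ((#A : ℝ) ^ t) ?_
    · rw [card_product, hAnc, nsmul_eq_mul] at h1
      push_cast at h1
      exact h1
    rintro ⟨a, b⟩ -
    obtain h0 | ⟨⟨g₀, a₀⟩, h0⟩ := ({p ∈ Ω | (p.2, p.1 • p.2) = (a, b)}).eq_empty_or_nonempty
    · simp only [h0, card_empty, Nat.cast_zero]
      positivity
    simp only [hΩ, mem_filter, mem_product, Prod.mk.injEq] at h0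
    obtain ⟨⟨⟨hg₀, ha⟩, -⟩, rfl, rfl⟩ := h0
    obtain ⟨haA, hsmall⟩ := mem_filter.1 ha
    have hnot : ¬ ((stabIn (Subgroup.closure (S : Set G) : Set G) a₀).Infinite ∨
        (#A : ℝ) ^ t ≤ ((stabIn (Subgroup.closure (S : Set G) : Set G) a₀).ncard : ℝ)) :=
      fun h ↦ hsmall ⟨Fintype.mem_piFinset.1 haA, h⟩
    rw [not_or, Set.not_infinite, not_le] at hnot
    refine le_trans ?_ hnot.2.le
    rw [Set.ncard_eq_toFinset_card _ hnot.1, Nat.cast_le]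
    refine card_le_card_of_injOn (fun p ↦ g₀⁻¹ * p.1) ?_ ?_
    · rintro ⟨g, x⟩ hp
      simp only [hΩ, coe_filter, mem_filter, mem_product, Prod.mk.injEq,
        Set.mem_ofPred_eq] at hp
      obtain ⟨⟨⟨hg, -⟩, -⟩, rfl, hgx⟩ := hp
      simp only [Set.Finite.coe_toFinset]
      refine ⟨?_, mul_mem (inv_mem (hFS _ hg₀)) (hFS _ hg)⟩
      simp [MulAction.mem_stabilizer_iff, mul_smul, hgx]
    · rintro ⟨g, x⟩ hp ⟨g', x'⟩ hp' h
      simp only [coe_filter, Prod.mk.injEq, Set.mem_ofPred_eq] at hp hp'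
      simp only [mul_right_inj] at h
      rw [h, hp.2.1, hp'.2.1]
  have h1 := hlow.trans hup
  rw [Real.rpow_add hN, Real.rpow_natCast]
  refine le_of_mul_le_mul_right ?_ (show 0 < (#A : ℝ) ^ n / (2 * K ^ n) by positivity)
  calc _ ≤ _ := h1
    _ = _ := by field_simp

/-- A subset of `A` of size at least `|A| / (2 K)` on which an approximate subgroup `H` expands
little, when `H` has a large part in a left translate of the set of `K`-rich elements. -/
lemma exists_small_product_set [DecidableEq G] (A : Finset X) (H D : Finset G)
    (hD : D.Nonempty) (y : G) (hDH : ∀ b ∈ D, y⁻¹ * b ∈ H) (hinv : (H : Set G)⁻¹ = H) {K : ℝ}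
    (hK : 0 < K) (hrich : ∀ b ∈ D, (#A : ℝ) ≤ K * overlap A b) :
    ∃ T ⊆ A, (#A : ℝ) ≤ 2 * K * #T ∧
      (#(H • T) : ℝ) * #D ≤ 2 * K * (#(H * H) * #A) := by
  have hD0 : (0 : ℝ) < #D := by exact_mod_cast hD.card_pos
  have hdc : ∑ a ∈ A, (#{b ∈ D | b • a ∈ A} : ℝ) = ∑ b ∈ D, (overlap A b : ℝ) := by
    exact_mod_cast sum_card_bipartiteAbove_eq_sum_card_bipartiteBelow (s := A) (t := D)
      (fun a b ↦ b • a ∈ A)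
  have hmean : (#D : ℝ) * #A ≤ K * ∑ a ∈ A, (#{b ∈ D | b • a ∈ A} : ℝ) := by
    rw [hdc, mul_sum, ← nsmul_eq_mul]
    exact card_nsmul_le_sum _ _ _ hrich
  have hpop := card_le_mul_card_popular A (fun a ↦ (#{b ∈ D | b • a ∈ A} : ℝ)) hD0 hK
    (fun a _ ↦ Nat.cast_le.2 (card_filter_le _ _)) hmean
  refine ⟨_, filter_subset _ _, hpop, ?_⟩
  -- Each point of `H • T` is `(y⁻¹ * b * h⁻¹)⁻¹ • (y⁻¹ • c)` with `c ∈ A`, for many `b ∈ D`.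
  have key := mul_card_le_card_of_fibers
    (Z := H • {a ∈ A | (#D : ℝ) ≤ 2 * K * (#{b ∈ D | b • a ∈ A} : ℝ)})
    (Q := (H * H) ×ˢ A) (ι := G) (fun q ↦ q.1⁻¹ • y⁻¹ • q.2) (m := #D / (2 * K)) ?_
  · rw [card_product, div_mul_eq_mul_div, div_le_iff₀ (by positivity)] at key
    push_cast at key
    linarith
  · intro z hz
    obtain ⟨h, hh, a, ha, rfl⟩ := mem_smul.1 hz
    refine ⟨{b ∈ D | b • a ∈ A}, fun b ↦ (y⁻¹ * b * h⁻¹, b • a), ?_, ?_, ?_⟩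
    · rw [div_le_iff₀' (by positivity)]
      exact (mem_filter.1 ha).2
    · intro b _ b' _ hbb
      simpa using congrArg Prod.fst hbb
    · intro b hb
      obtain ⟨hbD, hbA⟩ := mem_filter.1 hb
      refine ⟨mem_product.2 ⟨mul_mem_mul (hDH b hbD) ?_, hbA⟩, by simp [mul_smul]⟩
      have : h⁻¹ ∈ (H : Set G)⁻¹ := by simpa using hh
      rw [hinv] at this
      exact this

end Rich

/-! ### Sets spread over translates of `S` -/

section Spread

open Finset

variable {G : Type*} [Group G] [DecidableEq G]

/-- `B` is spread out over translates of `S`, with loss `W`: every subset of `B` has a left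
translate whose density in `S` is at least `1 / W` times the density of the subset in `B`. -/
def IsSpreadOver (S B : Finset G) (W : ℝ) : Prop :=
  ∀ D ⊆ B, ∃ g : G, (#D : ℝ) * #S ≤ W * (#B * #{d ∈ D | g * d ∈ S})

/-- The popular quotients of a spread set form a spread set: a subset `D` of them accounts for many
pairs of `B`, so some `b ∈ B` has many `b' ∈ B` with `b⁻¹ * b' ∈ D`, and the spread of `B` applies
to these `b'`. -/
lemma IsSpreadOver.popular_quotients {S B P : Finset G} {Γ : Finset (G × G)} {W V : ℝ} {R : ℕ}
    (hB : B.Nonempty) (h : IsSpreadOver S B W) (hW : 0 ≤ W) (hΓ : Γ ⊆ B ×ˢ B) (hR : 0 < R)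
    (hP : ∀ x ∈ P, R ≤ #{p ∈ Γ | p.1⁻¹ * p.2 = x}) (hV : (#B : ℝ) ^ 2 ≤ V * (R * #P)) :
    IsSpreadOver S P (W * V) := by
  intro D hDP
  have hR0 : (0 : ℝ) < R := by exact_mod_cast hR
  have hB0 : (0 : ℝ) < #B := by exact_mod_cast hB.card_pos
  have hcount : (#D : ℝ) * R ≤ ∑ b ∈ B, (#{b' ∈ B | b⁻¹ * b' ∈ D} : ℝ) := by
    norm_cast
    calc #D * R ≤ ∑ x ∈ D, #{p ∈ Γ | p.1⁻¹ * p.2 = x} :=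
          card_nsmul_le_sum _ _ _ fun x hx ↦ hP x (hDP hx)
      _ ≤ ∑ x ∈ D, #{p ∈ {p ∈ B ×ˢ B | p.1⁻¹ * p.2 ∈ D} | p.1⁻¹ * p.2 = x} := by
          refine sum_le_sum fun x hx ↦ card_le_card fun p hp ↦ ?_
          obtain ⟨h1, h2⟩ := mem_filter.1 hp
          exact mem_filter.2 ⟨mem_filter.2 ⟨hΓ h1, h2 ▸ hx⟩, h2⟩
      _ = #{p ∈ B ×ˢ B | p.1⁻¹ * p.2 ∈ D} :=
          (card_eq_sum_card_fiberwise fun p hp ↦ (mem_filter.1 hp).2).symm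
      _ = _ := by
          rw [card_filter, sum_product]
          exact sum_congr rfl fun b _ ↦ (card_filter _ _).symm
  obtain ⟨b, -, hb⟩ : ∃ b ∈ B, (#D : ℝ) * R / #B ≤ #{b' ∈ B | b⁻¹ * b' ∈ D} := by
    refine exists_le_of_sum_le hB ?_
    rw [sum_const, nsmul_eq_mul, mul_div_cancel₀ _ hB0.ne']
    exact hcount
  rw [div_le_iff₀ hB0] at hb
  obtain ⟨g, hg⟩ := h {b' ∈ B | b⁻¹ * b' ∈ D} (filter_subset _ _)
  refine ⟨g * b, ?_⟩
  have hle : (#{b' ∈ {b' ∈ B | b⁻¹ * b' ∈ D} | g * b' ∈ S} : ℝ) ≤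
      #{d ∈ D | g * b * d ∈ S} := by
    norm_cast
    refine card_le_card_of_injOn (fun b' ↦ b⁻¹ * b') ?_ (mul_right_injective b⁻¹).injOn
    intro b' hb'
    simp only [coe_filter, mem_filter, Set.mem_ofPred_eq] at hb' ⊢
    exact ⟨hb'.1.2, by simpa [mul_assoc] using hb'.2⟩
  refine le_of_mul_le_mul_left ?_ hR0
  calc (R : ℝ) * (#D * #S) = (#D * R) * #S := by ring
    _ ≤ #{b' ∈ B | b⁻¹ * b' ∈ D} * #B * #S := by gcongr
    _ = (#{b' ∈ B | b⁻¹ * b' ∈ D} * #S) * #B := by ring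
    _ ≤ W * (#B * #{d ∈ D | g * b * d ∈ S}) * #B := by
        refine mul_le_mul_of_nonneg_right (hg.trans ?_) hB0.le
        gcongr
    _ = W * #{d ∈ D | g * b * d ∈ S} * (#B : ℝ) ^ 2 := by ring
    _ ≤ W * #{d ∈ D | g * b * d ∈ S} * (V * (R * #P)) := by gcongr
    _ = _ := by ring

end Spread

/-! ### Iteration up to a stable rich set -/

section Iteration

open Finset

variable {G X : Type*} [Group G] [MulAction G X] [DecidableEq G] [DecidableEq X]

/-- The elements of `S` that carry many incidences form a dense subset of `S`. -/
lemma exists_rich_subset (S : Finset G) (A : Finset X) (hS : S.Nonempty) (hA : A.Nonempty) {ε : ℝ}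
    (hinc : (#S : ℝ) * (#A : ℝ) ^ (1 - ε) ≤ ((incidences S A).ncard : ℝ)) :
    ∃ B ⊆ S, B.Nonempty ∧ (∀ b ∈ B, (#A : ℝ) ≤ 2 * (#A : ℝ) ^ ε * overlap A b) ∧
      IsSpreadOver S B (2 * (#A : ℝ) ^ ε) := by
  have hN : (0 : ℝ) < #A := by exact_mod_cast hA.card_pos
  have hS0 : (0 : ℝ) < #S := by exact_mod_cast hS.card_pos
  have h1 : ((incidences S A).ncard : ℝ) ≤ ∑ s ∈ S, (overlap A s : ℝ) := by
    have hsub : incidences S A ⊆ (({p ∈ S ×ˢ A | p.1 • p.2 ∈ A}.image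
        fun p ↦ (p.1, p.2, p.1 • p.2) : Finset (G × X × X)) : Set (G × X × X)) := by
      rintro ⟨s, a, b⟩ ⟨hs, ha, hb, hsab⟩
      simp only at hs ha hb hsab
      subst hsab
      simp [hs, ha, hb]
    have h2 := Set.ncard_le_ncard hsub (finite_toSet _)
    rw [Set.ncard_coe_finset] at h2
    norm_cast
    refine (h2.trans card_image_le).trans_eq ?_
    rw [card_filter, sum_product]
    exact sum_congr rfl fun s _ ↦ (card_filter _ _).symm
  have h2 : (#A : ℝ) * #S ≤ (#A : ℝ) ^ ε * ∑ s ∈ S, (overlap A s : ℝ) := by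
    have h3 : (#A : ℝ) ^ ε * (#A : ℝ) ^ (1 - ε) = #A := by
      rw [← Real.rpow_add hN]; simp
    calc (#A : ℝ) * #S = (#A : ℝ) ^ ε * (#S * (#A : ℝ) ^ (1 - ε)) := by
          rw [mul_left_comm, h3, mul_comm]
      _ ≤ _ := by gcongr; exact hinc.trans h1
  have h3 := card_le_mul_card_popular S (fun s ↦ (overlap A s : ℝ)) hN
    (Real.rpow_pos_of_pos hN ε) (fun s _ ↦ Nat.cast_le.2 (overlap_le A s)) h2
  set B : Finset G := {s ∈ S | (#A : ℝ) ≤ 2 * (#A : ℝ) ^ ε * overlap A s} with hB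
  have hBS : B ⊆ S := filter_subset _ _
  refine ⟨B, hBS, ?_, fun b hb ↦ (mem_filter.1 hb).2, fun D hD ↦ ⟨1, ?_⟩⟩
  · rw [nonempty_iff_ne_empty]
    intro h
    rw [h] at h3
    simp only [card_empty, Nat.cast_zero, mul_zero] at h3
    linarith
  · have h4 : {d ∈ D | 1 * d ∈ S} = D :=
      filter_true_of_mem fun d hd ↦ by simpa using hBS (hD hd)
    rw [h4]
    calc (#D : ℝ) * #S ≤ #D * (2 * (#A : ℝ) ^ ε * #B) := by gcongr
      _ = _ := by ring

/-- One step of the iteration: popular rich quotients of a rich spread set. -/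
lemma exists_popular_rich_quotients (S : Finset G) (A : Finset X) (hA : A.Nonempty)
    (B : Finset G) (hB : B.Nonempty) (hBS : ∀ b ∈ B, b ∈ Subgroup.closure (S : Set G))
    {K W Λ : ℝ} (hK : 0 < K) (hW : 0 ≤ W) (hrich : ∀ b ∈ B, (#A : ℝ) ≤ K * overlap A b)
    (hspread : IsSpreadOver S B W) (hΛ : 1 + Real.log #B ≤ Λ) :
    ∃ (Γ : Finset (G × G)) (P : Finset G), Γ ⊆ B ×ˢ B ∧ P.Nonempty ∧
      (∀ p ∈ Γ, p.1⁻¹ * p.2 ∈ P) ∧ (∀ x ∈ P, x ∈ Subgroup.closure (S : Set G)) ∧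
      (∀ x ∈ P, (#A : ℝ) ≤ 2 * K ^ 2 * overlap A x) ∧
      IsSpreadOver S P (W * (2 * K ^ 2 * Λ)) ∧ (#B : ℝ) ^ 2 ≤ 2 * K ^ 2 * Λ * #Γ := by
  classical
  have hB0 : (0 : ℝ) < #B := by exact_mod_cast hB.card_pos
  set Γ₀ : Finset (G × G) := {p ∈ B ×ˢ B | (#A : ℝ) ≤ 2 * K ^ 2 * overlap A (p.1⁻¹ * p.2)}
    with hΓ₀
  have hΓB : Γ₀ ⊆ B ×ˢ B := filter_subset _ _
  have hcard : (#B : ℝ) ^ 2 ≤ 2 * K ^ 2 * #Γ₀ := sq_card_le_mul_card_rich_pairs A hA B hK hrich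
  have hne : Γ₀.Nonempty := by
    rw [nonempty_iff_ne_empty]
    intro h
    rw [h] at hcard
    simp only [card_empty, Nat.cast_zero, mul_zero] at hcard
    nlinarith
  have hfib : ∀ x, #{p ∈ Γ₀ | p.1⁻¹ * p.2 = x} ≤ #B := by
    intro x
    refine card_le_card_of_injOn Prod.fst ?_ ?_
    · intro p hp
      exact (mem_product.1 (hΓB (mem_filter.1 hp).1)).1
    · rintro ⟨a, b⟩ hp ⟨a', b'⟩ hp' h
      simp only [coe_filter, Set.mem_ofPred_eq] at hp hp' h
      subst h
      have := hp.2.trans hp'.2.symm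
      rw [mul_right_inj] at this
      rw [this]
  obtain ⟨R, P, hR, hP, hRP, hΓP⟩ := exists_popular_values Γ₀ (fun p ↦ p.1⁻¹ * p.2) #B hfib hne
  have hV : (#B : ℝ) ^ 2 ≤ 2 * K ^ 2 * Λ * (R * #P) := by
    calc _ ≤ _ := hcard
      _ ≤ 2 * K ^ 2 * ((1 + Real.log #B) * (R * #P)) := by gcongr
      _ ≤ 2 * K ^ 2 * (Λ * (R * #P)) := by gcongr
      _ = _ := by ring
  have hlog : 0 ≤ Real.log #B := Real.log_natCast_nonneg _
  have hPq : ∀ x ∈ P, ∃ p ∈ Γ₀, p.1⁻¹ * p.2 = x := fun x hx ↦ mem_image.1 (hP hx)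
  refine ⟨{p ∈ Γ₀ | p.1⁻¹ * p.2 ∈ P}, P, (filter_subset _ _).trans hΓB, ?_,
    fun p hp ↦ (mem_filter.1 hp).2, ?_, ?_,
    hspread.popular_quotients hB hW hΓB hR hRP hV, ?_⟩
  · rw [nonempty_iff_ne_empty]
    intro h
    rw [h] at hV
    simp only [card_empty, Nat.cast_zero, mul_zero] at hV
    nlinarith
  · intro x hx
    obtain ⟨p, hp, rfl⟩ := hPq x hx
    have := mem_product.1 (hΓB hp)
    exact mul_mem (inv_mem (hBS _ this.1)) (hBS _ this.2)
  · intro x hx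
    obtain ⟨p, hp, rfl⟩ := hPq x hx
    exact (mem_filter.1 hp).2
  · refine hV.trans ?_
    have h1 : #P * R ≤ #{p ∈ Γ₀ | p.1⁻¹ * p.2 ∈ P} := by
      rw [card_eq_sum_card_fiberwise (s := {p ∈ Γ₀ | p.1⁻¹ * p.2 ∈ P})
        (f := fun p ↦ p.1⁻¹ * p.2) (t := P) (fun p hp ↦ (mem_filter.1 hp).2)]
      refine card_nsmul_le_sum _ _ _ fun x hx ↦ (hRP x hx).trans (card_le_card fun p hp ↦ ?_)
      obtain ⟨h1, h2⟩ := mem_filter.1 hp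
      exact mem_filter.2 ⟨mem_filter.2 ⟨h1, h2 ▸ hx⟩, h2⟩
    have h2 : (R : ℝ) * #P ≤ #{p ∈ Γ₀ | p.1⁻¹ * p.2 ∈ P} := by
      rw [mul_comm]; exact_mod_cast h1
    have : 0 ≤ 2 * K ^ 2 * Λ := by
      have : 0 ≤ Λ := by linarith
      positivity
    gcongr

/-- A rich set, spread over translates of `S`, that does not grow by more than a factor `Q` when it
is replaced by a set of quotients of many of its pairs. -/
def HasStableRichSet (S : Finset G) (A : Finset X) (Q : ℝ) : Prop :=
  ∃ (B : Finset G) (Γ : Finset (G × G)) (P : Finset G), B.Nonempty ∧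
    (∀ b ∈ B, b ∈ Subgroup.closure (S : Set G)) ∧ (∀ b ∈ B, (#A : ℝ) ≤ Q * overlap A b) ∧
    IsSpreadOver S B Q ∧ Γ ⊆ B ×ˢ B ∧ (∀ p ∈ Γ, p.1⁻¹ * p.2 ∈ P) ∧
    (#B : ℝ) ^ 2 ≤ Q * #Γ ∧ (#P : ℝ) ≤ Q * #B

lemma IsSpreadOver.mono {S B : Finset G} {W W' : ℝ} (h : IsSpreadOver S B W) (hW : W ≤ W') :
    IsSpreadOver S B W' := fun D hD ↦ by
  obtain ⟨g, hg⟩ := h D hD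
  exact ⟨g, hg.trans (by gcongr)⟩

/-- Iteration of `exists_popular_rich_quotients`: as long as no stable set is met, the sets grow by
a factor `Q` at each step, while the losses in richness and spread stay below a power of `Λ`. -/
lemma hasStableRichSet_or_exists_large (S : Finset G) (A : Finset X) (hA : A.Nonempty)
    {Λ Q : ℝ} (hΛ2 : 2 ≤ Λ)
    (hΛ : ∀ F : Finset G, (∀ g ∈ F, g ∈ Subgroup.closure (S : Set G)) →
      (∀ g ∈ F, (#A : ℝ) ≤ Q * overlap A g) → 1 + Real.log #F ≤ Λ)
    (B₀ : Finset G) (hB₀ : B₀.Nonempty) (hB₀S : B₀ ⊆ S)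
    (hrich₀ : ∀ b ∈ B₀, (#A : ℝ) ≤ Λ ^ 4 * overlap A b) (hspread₀ : IsSpreadOver S B₀ (Λ ^ 4))
    (j : ℕ) (hj : Λ ^ (4 ^ (j + 1)) ≤ Q) :
    HasStableRichSet S A Q ∨ ∃ B : Finset G, B.Nonempty ∧
      (∀ b ∈ B, b ∈ Subgroup.closure (S : Set G)) ∧
      (∀ b ∈ B, (#A : ℝ) ≤ Λ ^ (4 ^ (j + 1)) * overlap A b) ∧
      IsSpreadOver S B (Λ ^ (4 ^ (j + 1))) ∧ Q ^ j ≤ #B := by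
  have hΛ0 : 0 < Λ := by linarith
  have hΛ1 : 1 ≤ Λ := by linarith
  induction j with
  | zero =>
    refine Or.inr ⟨B₀, hB₀, fun b hb ↦ Subgroup.subset_closure (hB₀S hb), by simpa using hrich₀,
      by simpa using hspread₀, ?_⟩
    simpa using hB₀.card_pos
  | succ j ih =>
    set e := 4 ^ (j + 1) with he
    have he4 : 4 ≤ e := by
      rw [he, pow_succ]; have := Nat.one_le_pow j 4 (by norm_num); omega
    have hee : 4 ^ (j + 1 + 1) = 4 * e := by rw [he]; ring
    rw [hee] at hj ⊢
    have hjQ : Λ ^ e ≤ Q := (pow_le_pow_right₀ hΛ1 (by omega)).trans hj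
    obtain h | ⟨B, hB, hBS, hrich, hspread, hcard⟩ := ih hjQ
    · exact Or.inl h
    have hrichQ : ∀ b ∈ B, (#A : ℝ) ≤ Q * overlap A b := fun b hb ↦ (hrich b hb).trans (by gcongr)
    obtain ⟨Γ, P, hΓB, hP, hΓP, hPS, hPrich, hPspread, hBΓ⟩ :=
      exists_popular_rich_quotients S A hA B hB hBS (pow_pos hΛ0 e) (pow_pos hΛ0 e).le hrich
        hspread (hΛ B hBS hrichQ)
    have hV : 2 * (Λ ^ e) ^ 2 * Λ ≤ Λ ^ (4 * e) := by
      calc 2 * (Λ ^ e) ^ 2 * Λ ≤ Λ * (Λ ^ e) ^ 2 * Λ := by gcongr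
        _ = Λ ^ (2 * e + 2) := by ring
        _ ≤ _ := pow_le_pow_right₀ hΛ1 (by omega)
    by_cases hgrow : (#P : ℝ) ≤ Q * #B
    · left
      refine ⟨B, Γ, P, hB, hBS, hrichQ, hspread.mono hjQ, hΓB, hΓP, hBΓ.trans ?_, hgrow⟩
      gcongr
      exact hV.trans hj
    · right
      refine ⟨P, hP, hPS, fun x hx ↦ (hPrich x hx).trans ?_, hPspread.mono ?_, ?_⟩
      · gcongr
        refine le_trans ?_ hV
        exact le_mul_of_one_le_right (by positivity) hΛ1
      · calc Λ ^ e * (2 * (Λ ^ e) ^ 2 * Λ) ≤ Λ ^ e * (Λ * (Λ ^ e) ^ 2 * Λ) := by gcongr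
          _ = Λ ^ (3 * e + 2) := by ring
          _ ≤ _ := pow_le_pow_right₀ hΛ1 (by omega)
      · have hQ0 : 0 ≤ Q := le_trans (by positivity) hjQ
        calc Q ^ (j + 1) = Q * Q ^ j := by ring
          _ ≤ Q * #B := by gcongr
          _ ≤ _ := (not_le.1 hgrow).le

/-- A stable rich set yields the approximate subgroup and the set on which it expands little. -/
lemma HasStableRichSet.exists_approximateSubgroup {S : Finset G} {A : Finset X} {Q m : ℝ}
    (h : HasStableRichSet S A Q) (hQ : 2 ≤ Q)
    (hm : ∀ F : Finset G, (∀ g ∈ F, g ∈ Subgroup.closure (S : Set G)) →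
      (∀ g ∈ F, (#A : ℝ) ≤ Q * overlap A g) → (#F : ℝ) ≤ m) :
    ∃ (H : Finset G) (T : Finset X), IsApproximateSubgroup (Q ^ 600) (H : Set G) ∧ T ⊆ A ∧
      (#H : ℝ) ≤ Q ^ 600 * m ∧
      (∃ g : G, (#S : ℝ) ≤ Q ^ 601 * (((H : Set G) ∩ g • (S : Set G)).ncard : ℝ)) ∧
      (#A : ℝ) ≤ Q ^ 2 * #T ∧ (#(H • T) : ℝ) ≤ Q ^ 1802 * #A := by
  obtain ⟨B, Γ, P, hB, hBS, hrich, hspread, hΓB, hΓP, hBΓ, hPB⟩ := h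
  have hQ0 : 0 < Q := by linarith
  have hB0 : (0 : ℝ) < #B := by exact_mod_cast hB.card_pos
  obtain ⟨H, y, hH, hHB, hBH⟩ :=
    exists_approximateSubgroup_of_popular_quotients B hB Γ hΓB P hΓP hQ hBΓ hPB
  set D : Finset G := {b ∈ B | y⁻¹ * b ∈ H} with hD
  have hD0 : (0 : ℝ) < #D := by
    by_contra! hneg
    have h0 : (#D : ℝ) = 0 := le_antisymm hneg (Nat.cast_nonneg _)
    rw [h0, mul_zero] at hBH
    linarith
  obtain ⟨T, hTA, hT, hHT⟩ := exists_small_product_set A H D (card_pos.1 (by exact_mod_cast hD0)) y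
    (fun b hb ↦ (mem_filter.1 hb).2) hH.inv_eq_self hQ0
    fun b hb ↦ hrich b (mem_filter.1 hb).1
  refine ⟨H, T, hH, hTA, hHB.trans ?_, ?_, ?_, ?_⟩
  · gcongr
    exact hm B hBS hrich
  · obtain ⟨g, hg⟩ := hspread D (filter_subset _ _)
    refine ⟨(g * y)⁻¹, ?_⟩
    have h1 : (#{d ∈ D | g * d ∈ S} : ℝ) ≤ (((H : Set G) ∩ (g * y)⁻¹ • (S : Set G)).ncard : ℝ) := by
      rw [← card_image_of_injective _ (mul_right_injective y⁻¹), ← Set.ncard_coe_finset,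
        Nat.cast_le]
      refine Set.ncard_le_ncard ?_ ((finite_toSet H).subset Set.inter_subset_left)
      intro x hx
      simp only [coe_image, coe_filter, Set.mem_image, Set.mem_ofPred_eq] at hx
      obtain ⟨d, ⟨hdD, hdS⟩, rfl⟩ := hx
      refine ⟨(mem_filter.1 hdD).2, ?_⟩
      rw [Set.mem_smul_set_iff_inv_smul_mem]
      simpa [mul_assoc] using hdS
    refine le_of_mul_le_mul_left ?_ hD0
    calc (#D : ℝ) * #S ≤ Q * (#B * #{d ∈ D | g * d ∈ S}) := hg
      _ ≤ Q * (Q ^ 600 * #D * (((H : Set G) ∩ (g * y)⁻¹ • (S : Set G)).ncard : ℝ)) := by gcongr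
      _ = _ := by ring
  · calc (#A : ℝ) ≤ 2 * Q * #T := hT
      _ ≤ Q * Q * #T := by gcongr
      _ = _ := by ring
  · refine le_of_mul_le_mul_right ?_ hD0
    calc (#(H • T) : ℝ) * #D ≤ 2 * Q * (#(H * H) * #A) := hHT
      _ ≤ Q * Q * (Q ^ 600 * (Q ^ 600 * (Q ^ 600 * #D)) * #A) := by
          gcongr
          refine hH.card_mul_self_le.trans ?_
          gcongr
          exact hHB.trans (by gcongr)
      _ = _ := by
          have : Q ^ 1802 = Q * Q * (Q ^ 600 * (Q ^ 600 * Q ^ 600)) := by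
            rw [← pow_add, ← pow_add, ← sq, ← pow_add]
          rw [this]; ring

end Iteration

/-! ### Choice of the parameters -/

section Parameters

/-- Constants and logarithms of `N` are below a given positive power of `N` once `N` is large. -/
lemma exists_two_le_and_log_le_rpow (c θ : ℝ) (hθ : 0 < θ) :
    ∃ N₀ : ℝ, 1 ≤ N₀ ∧ ∀ N, N₀ ≤ N → 2 ≤ N ^ θ ∧ 1 + c * Real.log N ≤ N ^ θ := by
  have h1 : Filter.Tendsto (fun N : ℝ ↦ N ^ θ) Filter.atTop Filter.atTop := tendsto_rpow_atTop hθ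
  have h2 : ∀ᶠ N : ℝ in Filter.atTop, ‖1 + c * Real.log N‖ ≤ 1 * ‖N ^ θ‖ := by
    have h3 : (fun N : ℝ ↦ 1 + c * Real.log N) =o[Filter.atTop] fun N ↦ N ^ θ := by
      refine Asymptotics.IsLittleO.add ?_ ((isLittleO_log_rpow_atTop hθ).const_mul_left c)
      exact (Asymptotics.isLittleO_const_left.2 (Or.inr
        (tendsto_norm_atTop_atTop.comp h1)))
    exact h3.bound one_pos
  have h4 := (h1.eventually_ge_atTop 2).and (h2.and (Filter.eventually_ge_atTop (1 : ℝ)))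
  obtain ⟨N₁, hN₁⟩ := Filter.eventually_atTop.1 h4
  refine ⟨max N₁ 1, le_max_right _ _, fun N hN ↦ ?_⟩
  obtain ⟨h5, h6, h7⟩ := hN₁ N ((le_max_left _ _).trans hN)
  refine ⟨h5, ?_⟩
  rw [one_mul, Real.norm_of_nonneg (Real.rpow_nonneg (by linarith) θ)] at h6
  exact (le_abs_self _).trans h6

end Parameters

theorem corollaryc (n : ℕ) (hn : 0 < n) (r t : ℝ) (hr : 0 < r) (ht : 0 < t)
    (δ : ℝ) (hδ : 0 < δ) :
    ∃ ε : ℝ, 0 < ε ∧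
      ∀ (G : Type*) [Group G] (X : Type*) [MulAction G X] (S : Finset G) (A : Finset X),
        1 / ε < (A.card : ℝ) ^ (1 / r) →
        (A.card : ℝ) ^ (1 / r) ≤ (S.card : ℝ) →
        (S.card : ℝ) ≤ (A.card : ℝ) ^ r →
        ((largeStabTuples n t S A).ncard : ℝ) ≤ (A.card : ℝ) ^ ((n : ℝ) - δ) →
        (S.card : ℝ) * (A.card : ℝ) ^ (1 - ε) ≤ ((incidences S A).ncard : ℝ) →
        ∃ (H : Finset G) (T : Finset X),
          IsApproximateSubgroup ((A.card : ℝ) ^ δ) (H : Set G) ∧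
          T ⊆ A ∧
          (H.card : ℝ) ≤ (A.card : ℝ) ^ ((n : ℝ) + t + δ) ∧
          (∃ h : G, (A.card : ℝ) ^ (-δ) * (S.card : ℝ) ≤
            (((H : Set G) ∩ h • (S : Set G)).ncard : ℝ)) ∧
          (A.card : ℝ) ^ (1 - δ) ≤ (T.card : ℝ) ∧
          (((H : Set G) • (T : Set X)).ncard : ℝ) ≤ (A.card : ℝ) ^ (1 + δ) := by
  -- With `Q = |A| ^ η`, a loss of `Q ^ (1802 + n)` is exactly `|A| ^ δ`.
  set η : ℝ := δ / (1802 + n) with hη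
  have hm0 : (0 : ℝ) < 1802 + n := by positivity
  have hη0 : 0 < η := by positivity
  -- `J` steps of growth by `Q` exceed the bound for the number of `Q`-rich elements.
  set J : ℕ := n + 2 + ⌈((n : ℝ) + t) / η⌉₊ with hJ
  -- `θ` is such that `Λ = |A| ^ θ` satisfies `Λ ^ (4 ^ (J + 1)) = Q`: the losses reach `Q` only
  -- after `J` steps.
  set θ : ℝ := η / (4 ^ (J + 1) : ℕ) with hθ
  have hθ0 : 0 < θ := by positivity
  obtain ⟨N₀, hN₀1, hN₀⟩ := exists_two_le_and_log_le_rpow ((n : ℝ) + t + δ) θ hθ0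
  have hN₀0 : 0 < N₀ := by linarith
  -- The second term of the minimum makes `1 / ε < |A| ^ (1 / r)` imply `N₀ ≤ |A|`.
  refine ⟨min θ (N₀ ^ (-(1 / r))), lt_min hθ0 (Real.rpow_pos_of_pos hN₀0 _), ?_⟩
  intro G _ X _ S A hεA hAS _ hbad hinc
  classical
  set ε : ℝ := min θ (N₀ ^ (-(1 / r))) with hε
  have hε0 : 0 < ε := lt_min hθ0 (Real.rpow_pos_of_pos hN₀0 _)
  set N : ℝ := (A.card : ℝ) with hNdef
  have hNn : 0 ≤ N := Nat.cast_nonneg _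
  have hNN₀ : N₀ ≤ N := by
    have h1 : N₀ ^ (1 / r) ≤ 1 / ε := by
      rw [le_one_div (Real.rpow_pos_of_pos hN₀0 _) hε0, one_div, ← Real.rpow_neg hN₀0.le]
      exact min_le_right _ _
    exact ((Real.rpow_lt_rpow_iff hN₀0.le hNn (by positivity)).1 (h1.trans_lt hεA)).le
  have hN1 : 1 ≤ N := hN₀1.trans hNN₀
  have hN0 : 0 < N := by linarith
  obtain ⟨hΛ2, hΛlog⟩ := hN₀ N hNN₀
  have hA : A.Nonempty := Finset.card_pos.1 ((Nat.cast_pos (α := ℝ)).1 hN0)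
  have hS : S.Nonempty := by
    refine Finset.card_pos.1 (Nat.cast_pos (α := ℝ).1 (lt_of_lt_of_le ?_ hAS))
    positivity
  set Λ : ℝ := N ^ θ with hΛdef
  set Q : ℝ := N ^ η with hQdef
  have hΛ1 : 1 ≤ Λ := by linarith
  have hΛQ : Λ ^ (4 ^ (J + 1)) = Q := by
    rw [hΛdef, hQdef, ← Real.rpow_mul_natCast hNn, hθ, div_mul_cancel₀]
    positivity
  have hQ2 : 2 ≤ Q := by
    rw [← hΛQ]
    exact hΛ2.trans (le_self_pow₀ hΛ1 (by positivity))
  have hQ0 : 0 < Q := by linarith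
  have hQ1 : 1 ≤ Q := by linarith
  have hQδ : Q ^ (1802 + n) = N ^ δ := by
    rw [hQdef, ← Real.rpow_mul_natCast hNn, hη]
    push_cast
    rw [div_mul_cancel₀ _ hm0.ne']
  have hQle : ∀ k : ℕ, k ≤ 1802 + n → Q ^ k ≤ N ^ δ := fun k hk ↦ by
    rw [← hQδ]
    exact pow_le_pow_right₀ hQ1 hk
  have h2Q : 2 * Q ^ n ≤ Q ^ (n + 1) := by
    rw [pow_succ']
    gcongr
  have hrich : ∀ F : Finset G, (∀ g ∈ F, g ∈ Subgroup.closure (S : Set G)) →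
      (∀ g ∈ F, N ≤ Q * overlap A g) → (F.card : ℝ) ≤ Q ^ (n + 1) * N ^ ((n : ℝ) + t) := by
    intro F hFS hF
    refine (card_le_of_rich S A hA hbad hQ0 (h2Q.trans (hQle _ (by omega))) F hFS hF).trans ?_
    gcongr
  have hlog : ∀ F : Finset G, (∀ g ∈ F, g ∈ Subgroup.closure (S : Set G)) →
      (∀ g ∈ F, N ≤ Q * overlap A g) → 1 + Real.log F.card ≤ Λ := by
    intro F hFS hF
    obtain rfl | hFne := F.eq_empty_or_nonempty
    · simpa using hΛ1
    refine le_trans ?_ hΛlog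
    have h1 : (F.card : ℝ) ≤ N ^ ((n : ℝ) + t + δ) := by
      rw [add_comm _ δ, Real.rpow_add hN0]
      refine (hrich F hFS hF).trans ?_
      gcongr
      exact hQle _ (by omega)
    have h2 := Real.log_le_log (by exact_mod_cast hFne.card_pos) h1
    rw [Real.log_rpow hN0] at h2
    linarith
  have hlossΛ : 2 * N ^ ε ≤ Λ ^ 4 := by
    calc 2 * N ^ ε ≤ Λ * Λ := by
          gcongr
          exact Real.rpow_le_rpow_of_exponent_le hN1 (min_le_left _ _)
      _ = Λ ^ 2 := by ring
      _ ≤ Λ ^ 4 := pow_le_pow_right₀ hΛ1 (by norm_num)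
  obtain ⟨B₀, hB₀S, hB₀, hB₀rich, hB₀spread⟩ := exists_rich_subset S A hS hA hinc
  have hstable : HasStableRichSet S A Q := by
    obtain h | ⟨B, hB, hBS, hBrich, -, hBcard⟩ :=
      hasStableRichSet_or_exists_large S A hA hΛ2 hlog B₀ hB₀ hB₀S
        (fun b hb ↦ (hB₀rich b hb).trans (by gcongr)) (hB₀spread.mono hlossΛ) J hΛQ.le
    · exact h
    exfalso
    rw [hΛQ] at hBrich
    have h1 := hBcard.trans (hrich B hBS hBrich)
    have h2 : N ^ ((n : ℝ) + t) ≤ Q ^ ⌈((n : ℝ) + t) / η⌉₊ := by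
      rw [hQdef, ← Real.rpow_mul_natCast hNn]
      refine Real.rpow_le_rpow_of_exponent_le hN1 ?_
      rw [← div_le_iff₀' hη0]
      exact Nat.le_ceil _
    have h3 : Q ^ J = Q * (Q ^ (n + 1) * Q ^ ⌈((n : ℝ) + t) / η⌉₊) := by rw [hJ]; ring
    have h4 : Q ^ (n + 1) * N ^ ((n : ℝ) + t) ≤ Q ^ (n + 1) * Q ^ ⌈((n : ℝ) + t) / η⌉₊ := by
      gcongr
    have h5 : 0 < Q ^ (n + 1) * Q ^ ⌈((n : ℝ) + t) / η⌉₊ := by positivity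
    nlinarith
  obtain ⟨H, T, hH, hTA, hHcard, ⟨g, hg⟩, hT, hHT⟩ := hstable.exists_approximateSubgroup hQ2 hrich
  have hNδ : 0 < N ^ δ := Real.rpow_pos_of_pos hN0 δ
  refine ⟨H, T, hH.mono (hQle _ (by omega)), hTA, hHcard.trans ?_, ⟨g, ?_⟩, ?_, ?_⟩
  · rw [← mul_assoc, ← pow_add, add_comm _ δ, Real.rpow_add hN0 δ]
    gcongr
    exact hQle _ (by omega)
  · rw [Real.rpow_neg hNn, inv_mul_le_iff₀ hNδ]
    refine hg.trans ?_
    gcongr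
    exact hQle _ (by omega)
  · rw [Real.rpow_sub hN0, Real.rpow_one, div_le_iff₀' hNδ]
    refine hT.trans ?_
    gcongr
    exact hQle _ (by omega)
  · rw [← Finset.coe_smul, Set.ncard_coe_finset, add_comm, Real.rpow_add hN0, Real.rpow_one]
    refine hHT.trans ?_
    gcongr
    exact hQle _ (by omega)
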